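/- All graphs are finite and simple, and considered up to isomorphism. A graph $G$ is \emph{$k$-critical} if $\chi(G)=k$ and no proper induced subgraph of $G$ has chromatic number $k$. A graph is \emph{$(P_5,\overline{P}_5)$-free} if it has no induced subgraph isomorphic to the path $P_5$ on five vertices or to its complement $\overline{P}_5$. Let $\mathcal{C}_k$ denote the class of $k$-critical $(P_5,\overline{P}_5)$-free graphs. The \emph{join} of two graphs is their disjoint union together with all edges between them. The \emph{buoy with bags} $B_1,\dots,B_5$ is the graph obtained from the cycle $C_5$ with vertices $1,\dots,5$ in cyclic order by substituting the graph $B_i$ for each vertex $i$: it is the disjoint union of $B_1,\dots,B_5$ together with all edges between $B_i$ and $B_{i+1}$ for each $i$, with indices modulo $5$. \textbf{Theorem.} Let $k\ge 2$ be an integer. A graph $G$ belongs to $\mathcal{C}_k$ if and only if at least one of the following holds. (1) There are positive integers $k_1,k_2$ with $k_1+k_2=k$ such that $G$ is the join of a member of $\mathcal{C}_{k_1}$ and a member of $\mathcal{C}_{k_2}$. (2) There are positive integers $k_1,\dots,k_5$ with $k_i+k_{i+1}\le k-1$ for each $i$ (indices modulo $5$) and $\sum_{i=1}^5 k_i=2k-1$,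 such that $G$ is a buoy with bags $B_1,\dots,B_5$ where $B_i$ is a member of $\mathcal{C}_{k_i}$ for each $i$. -/

import Mathlib

universe u v

namespace SimpleGraph

/-- `G` is `k`-critical: it has chromatic number `k`, and no proper induced subgraph of `G` has
chromatic number `k`. -/
def IsCritical {V : Type u} (G : SimpleGraph V) (k : ℕ) : Prop :=
  G.chromaticNumber = (k : ℕ∞) ∧
    ∀ S : Set V, S ≠ Set.univ → (G.induce S).chromaticNumber ≠ (k : ℕ∞)

/-- `G` has no induced subgraph isomorphic to the path `P₅` on five vertices, nor to its
complement. -/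
def IsP5CoP5Free {V : Type u} (G : SimpleGraph V) : Prop :=
  ¬ (pathGraph 5).IsIndContained G ∧ ¬ (pathGraph 5)ᶜ.IsIndContained G

/-- Membership in the family `𝒞 k` of `k`-critical `(P₅, co-P₅)`-free graphs. -/
def MemC {V : Type u} (G : SimpleGraph V) (k : ℕ) : Prop :=
  G.IsCritical k ∧ G.IsP5CoP5Free

/-- The join of two graphs: their disjoint union together with all edges between them. -/
def joinGraph {V : Type u} {W : Type v} (G : SimpleGraph V) (H : SimpleGraph W) :
    SimpleGraph (V ⊕ W) where
  Adj
    | Sum.inl a, Sum.inl b => G.Adj a b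
    | Sum.inr a, Sum.inr b => H.Adj a b
    | Sum.inl _, Sum.inr _ => True
    | Sum.inr _, Sum.inl _ => True
  symm := ⟨by
    rintro (a | a) (b | b) h
    · exact G.adj_symm h
    · trivial
    · trivial
    · exact H.adj_symm h⟩
  loopless := ⟨by
    rintro (a | a) h
    · exact G.irrefl h
    · exact H.irrefl h⟩

/-- The graph obtained from `G` by substituting, for every vertex `i` of `G`, the graph `B i`:
vertices of one `B i` are adjacent as in `B i`, and a vertex of `B i` is adjacent to a vertex of
`B j`, for `i ≠ j`, exactly when `i` and `j` are adjacent in `G`. -/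
def substitute {ι : Type v} (G : SimpleGraph ι) {W : ι → Type u} (B : ∀ i, SimpleGraph (W i)) :
    SimpleGraph (Σ i, W i) where
  Adj x y := G.Adj x.1 y.1 ∨ ∃ (i : ι) (a b : W i), x = ⟨i, a⟩ ∧ y = ⟨i, b⟩ ∧ (B i).Adj a b
  symm := ⟨by
    rintro x y (h | ⟨i, a, b, rfl, rfl, h⟩)
    · exact Or.inl h.symm
    · exact Or.inr ⟨i, b, a, rfl, rfl, h.symm⟩⟩
  loopless := ⟨by
    rintro x (h | ⟨i, a, b, h₁, h₂, h⟩)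
    · exact G.irrefl h
    · obtain rfl : a = b := by
        have := h₁.symm.trans h₂
        simpa using this
      exact (B i).irrefl h⟩

/-- The buoy with bags `B 0, …, B 4`, in this cyclic order. -/
def buoy {W : Fin 5 → Type u} (B : ∀ i, SimpleGraph (W i)) : SimpleGraph (Σ i, W i) :=
  (cycleGraph 5).substitute B

/-- `G` is (isomorphic to) the join of a member of `𝒞 k₁` and a member of `𝒞 k₂`, where `k₁` and
`k₂` are positive integers with `k₁ + k₂ = k`. -/
def IsConstruction1 {V : Type u} (G : SimpleGraph V) (k : ℕ) : Prop :=
  ∃ (k₁ k₂ : ℕ) (V₁ V₂ : Type u) (G₁ : SimpleGraph V₁) (G₂ : SimpleGraph V₂),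
    0 < k₁ ∧ 0 < k₂ ∧ k₁ + k₂ = k ∧ G₁.MemC k₁ ∧ G₂.MemC k₂ ∧
      Nonempty (G ≃g G₁.joinGraph G₂)

/-- `G` is (isomorphic to) a buoy whose bags `B i` are members of `𝒞 (κ i)` for positive integers
`κ i` satisfying the stated constraints; `i + 1` is addition modulo `5`. -/
def IsConstruction2 {V : Type u} (G : SimpleGraph V) (k : ℕ) : Prop :=
  ∃ (κ : Fin 5 → ℕ) (W : Fin 5 → Type u) (B : ∀ i, SimpleGraph (W i)),
    (∀ i, 0 < κ i) ∧ (∀ i, κ i + κ (i + 1) ≤ k - 1) ∧ ∑ i, κ i = 2 * k - 1 ∧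
      (∀ i, (B i).MemC (κ i)) ∧ Nonempty (G ≃g buoy B)

end SimpleGraph

/-!
A critical graph `G` with at least two vertices is finite by the De Bruijn–Erdős theorem, hence a
substitution into a prime quotient `Q` on at least two vertices.

If `Q` contains an induced `C₅`, take a maximal set of vertices of `Q` inducing a buoy. As `Q` is
`(P₅, co-P₅)`-free, a vertex outside this set that is adjacent to some but not all of it could be
added to one of the bags. So the set is a module, hence all of `Q`, and `G` is a buoy.

Otherwise replace every bag of `G` by a complete graph with the same chromatic number. The result
`H` is again critical, and it has no induced `P₅`, co-`P₅` or `C₅`, so that listing its vertices by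
decreasing degree gives a perfect order in the sense of Chvátal. Hence `H` is as colorable as its
cliques allow and is complete by criticality. So `Q` is complete and `G` is a join.

The numerical conditions come from weighted colorings: a substitution is critical if and only if its
bags are critical and the quotient is critical for the chromatic numbers of the bags as weights,
which is decided by the sum of the weights for a complete graph, and by that sum and the sums over
edges for an odd cycle.
-/

namespace P5CoP5

open SimpleGraph

/-! ### Critical graphs -/

section Criticality

variable {V W : Type*} {G : SimpleGraph V} {H : SimpleGraph W} {k n : ℕ}

theorem colorable_succ_of_isIndepSet {S : Set V} (hS : G.IsIndepSet S)
    (h : (G.induce Sᶜ).Colorable n) : G.Colorable (n + 1) := by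
  classical
  obtain ⟨c⟩ := h
  let C : G.Coloring (Option (Fin n)) := Coloring.mk
    (fun v => if hv : v ∈ S then none else some (c ⟨v, hv⟩)) (by
      intro a b hab
      by_cases ha : a ∈ S <;> by_cases hb : b ∈ S
      · exact absurd hab (hS ha hb hab.ne)
      · simp [ha, hb]
      · simp [ha, hb]
      · simpa [ha, hb] using c.valid (show (G.induce Sᶜ).Adj ⟨a, ha⟩ ⟨b, hb⟩ from hab))
  simpa using C.colorable

theorem colorable_succ_of_induce_compl_singleton {v : V} (h : (G.induce {v}ᶜ).Colorable n) :
    G.Colorable (n + 1) :=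
  colorable_succ_of_isIndepSet (Set.pairwise_singleton v _) h

theorem exists_chromaticNumber_eq (h : G.Colorable n) :
    ∃ m : ℕ, G.chromaticNumber = m ∧ m ≤ n := by
  obtain ⟨m, hm⟩ := ENat.ne_top_iff_exists.1 (chromaticNumber_ne_top_iff_exists.2 ⟨n, h⟩)
  exact ⟨m, hm.symm, by simpa [← hm] using h.chromaticNumber_le⟩

theorem colorable_iff_le_of_chromaticNumber_eq {m : ℕ} (h : G.chromaticNumber = m) :
    G.Colorable n ↔ m ≤ n := by
  rw [← chromaticNumber_le_iff_colorable, h, Nat.cast_le]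

theorem isCritical_iff (hk : 0 < k) :
    G.IsCritical k ↔ ¬ G.Colorable (k - 1) ∧ ∀ v, (G.induce {v}ᶜ).Colorable (k - 1) := by
  constructor
  · rintro ⟨hG, hsub⟩
    refine ⟨by rw [colorable_iff_le_of_chromaticNumber_eq hG]; omega, fun v => ?_⟩
    have hle : (G.induce {v}ᶜ).Colorable k :=
      ((colorable_iff_le_of_chromaticNumber_eq hG).2 le_rfl).of_hom (Embedding.induce _).toHom
    obtain ⟨m, hm, hmk⟩ := exists_chromaticNumber_eq hle
    have hne : m ≠ k := fun h => hsub {v}ᶜ (by simp) (h ▸ hm)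
    exact (colorable_iff_le_of_chromaticNumber_eq hm).2 (by omega)
  · rintro ⟨hG, hv⟩
    obtain ⟨v⟩ : Nonempty V := by
      by_contra! hV
      exact hG (.of_isEmpty _)
    have hcol : G.Colorable k := by
      simpa [Nat.sub_add_cancel hk] using colorable_succ_of_induce_compl_singleton (hv v)
    refine ⟨?_, fun S hS hSk => ?_⟩
    · obtain ⟨m, hm, hmk⟩ := exists_chromaticNumber_eq hcol
      rw [colorable_iff_le_of_chromaticNumber_eq hm] at hG
      rw [hm, show m = k by omega]
    · obtain ⟨w, hw⟩ := (Set.ne_univ_iff_exists_notMem S).1 hS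
      have hSw : S ≤ ({w}ᶜ : Set V) := fun x hx hxw => hw (hxw ▸ hx)
      have := (hv w).of_hom (G.induceHomOfLE hSw).toHom
      rw [colorable_iff_le_of_chromaticNumber_eq hSk] at this
      omega

theorem chromaticNumber_induce_compl_singleton_of_isCritical (hk : 0 < k) (h : G.IsCritical k)
    (v : V) : (G.induce {v}ᶜ).chromaticNumber = (k - 1 : ℕ) := by
  obtain ⟨m, hm, hmk⟩ := exists_chromaticNumber_eq (((isCritical_iff hk).1 h).2 v)
  have := (colorable_iff_le_of_chromaticNumber_eq h.1).1
    (colorable_succ_of_induce_compl_singleton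
      ((colorable_iff_le_of_chromaticNumber_eq hm).2 le_rfl))
  rw [hm, show m = k - 1 by omega]

theorem nonempty_of_isCritical (hk : 0 < k) (h : G.IsCritical k) : Nonempty V := by
  by_contra! hV
  exact ((isCritical_iff hk).1 h).1 (.of_isEmpty _)

theorem nontrivial_of_isCritical (hk : 2 ≤ k) (h : G.IsCritical k) : Nontrivial V := by
  by_contra hV
  rw [not_nontrivial_iff_subsingleton] at hV
  have : G.Colorable 1 :=
    ⟨Coloring.mk (fun _ => 0) fun hab => (hab.ne (Subsingleton.elim _ _)).elim⟩
  exact ((isCritical_iff (by omega)).1 h).1 (this.mono (by omega))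

/-- By the De Bruijn–Erdős theorem a graph that is not `(k - 1)`-colorable has a finite subgraph
that is not, and a critical graph is spanned by it. -/
theorem finite_of_isCritical (hk : 0 < k) (h : G.IsCritical k) : Finite V := by
  obtain ⟨hG, hv⟩ := (isCritical_iff hk).1 h
  by_contra hV
  refine hG (nonempty_hom_of_forall_finite_subgraph_hom (F := completeGraph (Fin (k - 1)))
    fun G' hG' => ?_)
  have hne : G'.verts ≠ Set.univ := fun e => hV (Set.finite_univ_iff.1 (e ▸ hG'))
  let w := Classical.choose ((Set.ne_univ_iff_exists_notMem _).1 hne)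
  have hw : w ∉ G'.verts := Classical.choose_spec ((Set.ne_univ_iff_exists_notMem _).1 hne)
  exact (hv w).some.comp
    ⟨fun x => ⟨x, fun hx => hw (hx ▸ x.2)⟩, fun hab => G'.adj_sub hab⟩

theorem isCritical_of_iso (hk : 0 < k) (e : G ≃g H) (h : G.IsCritical k) : H.IsCritical k := by
  rw [isCritical_iff hk] at h ⊢
  refine ⟨fun hH => h.1 ((colorable_congr e).2 hH), fun w => (h.2 (e.symm w)).of_hom
    ⟨fun x => ⟨e.symm x, fun hx => x.2 (e.symm.injective hx)⟩, fun hab => ?_⟩⟩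
  exact e.symm.map_rel_iff.2 hab

theorem eq_top_of_isCritical_of_not_cliqueFree (hk : 0 < k) (h : G.IsCritical k)
    (hcl : ¬ G.CliqueFree k) : G = ⊤ := by
  classical
  obtain ⟨s, hs⟩ := not_forall_not.1 hcl
  have hall : ∀ v, v ∈ s := by
    by_contra! ⟨v, hv⟩
    refine (((isCritical_iff hk).1 h).2 v).cliqueFree (Nat.sub_lt hk one_pos)
      (s.subtype (· ∈ ({v}ᶜ : Set V))) ((isNClique_induce_iff _ _ _).2 ?_)
    rwa [Finset.subtype_map_of_mem]
    exact fun x hx hxv => hv (hxv ▸ hx)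
  exact eq_top_iff.2 fun a b hab => hs.isClique (hall a) (hall b) hab

theorem isCritical_top [Fintype V] [Nonempty V] :
    (⊤ : SimpleGraph V).IsCritical (Fintype.card V) := by
  classical
  refine (isCritical_iff Fintype.card_pos).2 ⟨fun h => ?_, fun v => ?_⟩
  · have := (colorable_iff_le_of_chromaticNumber_eq (chromaticNumber_top (V := V))).1 h
    have := Fintype.card_pos (α := V)
    omega
  · have h := (induce ({v}ᶜ : Set V) (⊤ : SimpleGraph V)).colorable_of_fintype
    rwa [Fintype.card_compl_set {v}, Set.card_singleton] at h

end Criticality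

/-! ### Substitution and weighted colorings -/

section Substitution

variable {I J : Type*} {W : I → Type*} {Q : SimpleGraph I} {B : ∀ i, SimpleGraph (W i)}

theorem substitute_adj_of_ne {i j : I} {a : W i} {b : W j} (h : i ≠ j) :
    (Q.substitute B).Adj ⟨i, a⟩ ⟨j, b⟩ ↔ Q.Adj i j := by
  refine ⟨?_, Or.inl⟩
  rintro (hij | ⟨l, a', b', hi, hj, -⟩)
  · exact hij
  · exact absurd ((congrArg Sigma.fst hi).trans (congrArg Sigma.fst hj).symm) h

theorem substitute_adj_same {i : I} {a b : W i} :
    (Q.substitute B).Adj ⟨i, a⟩ ⟨i, b⟩ ↔ (B i).Adj a b := by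
  refine ⟨?_, fun h => Or.inr ⟨i, a, b, rfl, rfl, h⟩⟩
  rintro (h | ⟨l, a', b', ha, hb, h⟩)
  · exact (Q.irrefl h).elim
  · cases ha
    cases hb
    exact h

/-- An induced subgraph of a graph obtained by substitution is obtained by substituting induced
subgraphs of the bags. -/
def induceSubstituteIso (S : Set (Σ i, W i)) :
    (Q.substitute B).induce S ≃g Q.substitute fun i => (B i).induce (Sigma.mk i ⁻¹' S) where
  toFun x := ⟨x.1.1, x.1.2, x.2⟩
  invFun x := ⟨⟨x.1, x.2.1⟩, x.2.2⟩
  map_rel_iff' := by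
    rintro ⟨⟨i, a⟩, ha⟩ ⟨⟨j, b⟩, hb⟩
    by_cases h : i = j
    · subst h
      exact substitute_adj_same.trans (substitute_adj_same (Q := Q) (B := B)).symm
    · exact (substitute_adj_of_ne h).trans (substitute_adj_of_ne h).symm

variable {κ μ : I → ℕ} {k n : ℕ}

/-- `Q` has a weighted `n`-coloring for `κ`: every vertex `i` can be given at least `κ i` of `n`
colors so that adjacent vertices share no color. -/
def WeightColorable (Q : SimpleGraph I) (κ : I → ℕ) (n : ℕ) : Prop :=
  ∃ C : I → Finset (Fin n), (∀ i, κ i ≤ (C i).card) ∧ ∀ i j, Q.Adj i j → Disjoint (C i) (C j)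

/-- The weighted analogue of `k`-criticality (for `0 < k`): `Q` with weights `κ` has no weighted
`(k - 1)`-coloring, but lowering any single weight by one creates one. -/
def WeightCritical [DecidableEq I] (Q : SimpleGraph I) (κ : I → ℕ) (k : ℕ) : Prop :=
  ¬ WeightColorable Q κ (k - 1) ∧
    ∀ i, WeightColorable Q (Function.update κ i (κ i - 1)) (k - 1)

theorem WeightColorable.anti (h : WeightColorable Q κ n) (hμ : μ ≤ κ) : WeightColorable Q μ n := by
  obtain ⟨C, hC, hd⟩ := h
  exact ⟨C, fun i => (hμ i).trans (hC i), hd⟩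

theorem substitute_colorable_iff (hκ : ∀ i, (B i).chromaticNumber = κ i) :
    (Q.substitute B).Colorable n ↔ WeightColorable Q κ n := by
  classical
  have hκ' := fun i m => colorable_iff_le_of_chromaticNumber_eq (n := m) (hκ i)
  constructor
  · rintro ⟨c⟩
    let C (i : I) : Finset (Fin n) := (Set.range fun a => c ⟨i, a⟩).toFinset
    have hmem {i : I} (a : W i) : c ⟨i, a⟩ ∈ C i := by simp [C]
    refine ⟨C, fun i => (hκ' i _).1 ?_, fun i j hij => Finset.disjoint_left.2 fun x hi hj => ?_⟩
    · let c' : (B i).Coloring (C i) := Coloring.mk (fun a => ⟨c ⟨i, a⟩, hmem a⟩) fun hab e =>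
        c.valid (substitute_adj_same.2 hab) (congrArg Subtype.val e)
      exact (Fintype.card_coe (C i)) ▸ c'.colorable
    · simp only [C, Set.mem_toFinset, Set.mem_range] at hi hj
      obtain ⟨⟨a, ha⟩, b, hb⟩ := And.intro hi hj
      exact c.valid ((substitute_adj_of_ne hij.ne).2 hij) (ha.trans hb.symm)
  · rintro ⟨C, hC, hd⟩
    have c (i : I) : (B i).Coloring (C i) :=
      ((hκ' i _).2 (hC i)).toColoring (Fintype.card_coe (C i)).ge
    refine ⟨Coloring.mk (fun x => (c x.1 x.2 : Fin n)) ?_⟩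
    rintro ⟨i, a⟩ ⟨j, b⟩ hab e
    by_cases h : i = j
    · subst h
      exact (c i).valid (substitute_adj_same.1 hab) (Subtype.ext e)
    · exact Finset.disjoint_left.1 (hd i j ((substitute_adj_of_ne h).1 hab)) (c i a).2
        (e ▸ (c j b).2)

theorem substitute_induce_compl_singleton_colorable_iff [DecidableEq I]
    (hκ : ∀ i, (B i).chromaticNumber = κ i) {i : I} {a : W i} {m : ℕ}
    (hm : ((B i).induce {a}ᶜ).chromaticNumber = m) :
    ((Q.substitute B).induce {⟨i, a⟩}ᶜ).Colorable n ↔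
      WeightColorable Q (Function.update κ i m) n := by
  rw [colorable_congr (induceSubstituteIso _)]
  refine substitute_colorable_iff fun j => ?_
  by_cases h : j = i
  · subst h
    have hself : Sigma.mk j ⁻¹' ({⟨j, a⟩}ᶜ : Set (Σ i, W i)) = {a}ᶜ := by
      ext b
      simp
    rw [Function.update_self, hself, hm]
  · have huniv : Sigma.mk j ⁻¹' ({⟨i, a⟩}ᶜ : Set (Σ i, W i)) = Set.univ := by
      ext b
      simp [h]
    rw [Function.update_of_ne h, huniv, ← hκ j, chromaticNumber_congr (induceUnivIso _)]

/-- Deleting `a` must lower the weight of its bag, for otherwise `k` colors would still be needed;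
it lowers it by exactly one. -/
theorem colorable_and_weightColorable_update_of_isCritical_substitute [DecidableEq I] (hk : 0 < k)
    (h : (Q.substitute B).IsCritical k) (hκ : ∀ i, (B i).chromaticNumber = κ i) (i : I) (a : W i) :
    ((B i).induce {a}ᶜ).Colorable (κ i - 1) ∧
      WeightColorable Q (Function.update κ i (κ i - 1)) (k - 1) := by
  obtain ⟨hG, hdel⟩ := (isCritical_iff hk).1 h
  rw [substitute_colorable_iff hκ] at hG
  obtain ⟨m, hm, -⟩ := exists_chromaticNumber_eq
    (((colorable_iff_le_of_chromaticNumber_eq (hκ i)).2 le_rfl).of_hom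
      (Embedding.induce ({a}ᶜ : Set (W i))).toHom)
  have hcol := (substitute_induce_compl_singleton_colorable_iff hκ hm).1 (hdel ⟨i, a⟩)
  have hlt : m < κ i := by
    by_contra! hle
    exact hG (hcol.anti (le_update_self_iff.2 hle))
  have hle : κ i ≤ m + 1 := (colorable_iff_le_of_chromaticNumber_eq (hκ i)).1
    (colorable_succ_of_induce_compl_singleton
      ((colorable_iff_le_of_chromaticNumber_eq hm).2 le_rfl))
  obtain rfl : m = κ i - 1 := by omega
  exact ⟨(colorable_iff_le_of_chromaticNumber_eq hm).2 le_rfl, hcol⟩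

theorem isCritical_substitute_iff [DecidableEq I] [∀ i, Nonempty (W i)] (hk : 0 < k) :
    (Q.substitute B).IsCritical k ↔
      ∃ κ : I → ℕ, (∀ i, 0 < κ i) ∧ (∀ i, (B i).IsCritical (κ i)) ∧ WeightCritical Q κ k := by
  constructor
  · intro h
    have hbag (i) : (B i).Colorable k :=
      ((colorable_iff_le_of_chromaticNumber_eq h.1).2 le_rfl).of_hom
        ⟨Sigma.mk i, substitute_adj_same.2⟩
    choose κ hκ _ using fun i => exists_chromaticNumber_eq (hbag i)
    have hpos (i) : 0 < κ i := by
      exact_mod_cast hκ i ▸ Colorable.chromaticNumber_pos (hbag i)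
    have hdel := colorable_and_weightColorable_update_of_isCritical_substitute hk h hκ
    refine ⟨κ, hpos, fun i => (isCritical_iff (hpos i)).2 ⟨?_, fun a => (hdel i a).1⟩, ?_,
      fun i => (hdel i (Classical.arbitrary _)).2⟩
    · rw [colorable_iff_le_of_chromaticNumber_eq (hκ i)]
      exact (Nat.sub_lt (hpos i) one_pos).not_ge
    · exact (substitute_colorable_iff hκ).not.1 ((isCritical_iff hk).1 h).1
  · rintro ⟨κ, hpos, hB, hG, hdel⟩
    refine (isCritical_iff hk).2 ⟨?_, fun ⟨i, a⟩ => ?_⟩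
    · rwa [substitute_colorable_iff fun i => (hB i).1]
    · exact (substitute_induce_compl_singleton_colorable_iff (fun i => (hB i).1)
        (chromaticNumber_induce_compl_singleton_of_isCritical (hpos i) (hB i) a)).2 (hdel i)

end Substitution

section CompleteGraph

variable {I : Type*} [Fintype I] {κ : I → ℕ} {k n : ℕ}

theorem weightColorable_top_iff : WeightColorable (⊤ : SimpleGraph I) κ n ↔ ∑ i, κ i ≤ n := by
  classical
  constructor
  · rintro ⟨C, hC, hd⟩
    calc ∑ i, κ i ≤ ∑ i, (C i).card := Finset.sum_le_sum fun i _ => hC i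
      _ = (Finset.univ.biUnion C).card :=
        (Finset.card_biUnion fun i _ j _ hij => hd i j hij).symm
      _ ≤ n := by simpa using Finset.card_le_univ (Finset.univ.biUnion C)
  · intro h
    obtain ⟨f⟩ : Nonempty ((Σ i, Fin (κ i)) ↪ Fin n) :=
      Function.Embedding.nonempty_of_card_le (by simpa using h)
    refine ⟨fun i => Finset.univ.map ((Function.Embedding.sigmaMk i).trans f), fun i => by simp,
      fun i j hij => Finset.disjoint_left.2 fun x hi hj => hij.ne ?_⟩
    simp only [Finset.mem_map, Finset.mem_univ, true_and] at hi hj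
    obtain ⟨⟨a, rfl⟩, b, hab⟩ := And.intro hi hj
    exact (congrArg Sigma.fst (f.injective hab)).symm

theorem sum_update_sub_one [DecidableEq I] {i : I} (hi : 0 < κ i) :
    ∑ j, Function.update κ i (κ i - 1) j = ∑ j, κ j - 1 := by
  rw [Finset.sum_update_of_mem (Finset.mem_univ i), ← Finset.add_sum_erase _ κ (Finset.mem_univ i),
    Finset.sdiff_singleton_eq_erase]
  omega

theorem weightCritical_top_iff [DecidableEq I] [Nonempty I] (hκ : ∀ i, 0 < κ i) (hk : 0 < k) :
    WeightCritical (⊤ : SimpleGraph I) κ k ↔ ∑ i, κ i = k := by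
  have hpos : 0 < ∑ i, κ i := Finset.sum_pos (fun i _ => hκ i) Finset.univ_nonempty
  simp only [WeightCritical, weightColorable_top_iff, sum_update_sub_one (hκ _), forall_const]
  omega

end CompleteGraph

section OddCycle

theorem exists_sum_eq {ι : Type*} [Fintype ι] {l u : ι → ℕ} (hlu : l ≤ u) {t : ℕ}
    (hl : ∑ i, l i ≤ t) (hu : t ≤ ∑ i, u i) : ∃ d, l ≤ d ∧ d ≤ u ∧ ∑ i, d i = t := by
  classical
  induction t, hl using Nat.le_induction with
  | base => exact ⟨l, le_rfl, hlu, rfl⟩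
  | succ t _ ih =>
    obtain ⟨d, hld, hdu, rfl⟩ := ih (by omega)
    obtain ⟨i, -, hi⟩ := Finset.exists_lt_of_sum_lt (Nat.lt_of_succ_le hu)
    refine ⟨d + Pi.single i 1, hld.trans le_self_add, fun j => ?_, ?_⟩
    · obtain rfl | hj := eq_or_ne j i
      · simpa using hi
      · simpa [hj] using hdu j
    · simp [Finset.sum_add_distrib]

theorem exists_forall_succ_modEq_add {m n : ℕ} {d : Fin (m + 1) → ℕ} (h : n ∣ ∑ i, d i) :
    ∃ s : Fin (m + 1) → ℕ, ∀ i, s (i + 1) ≡ s i + d i [MOD n] := by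
  refine ⟨fun i => ∑ j < i, d j, fun i => ?_⟩
  have hIic : ∑ j < i, d j + d i = ∑ j ≤ i, d j := by
    rw [← Finset.Iio_insert, Finset.sum_insert (by simp), add_comm]
  beta_reduce
  rw [hIic]
  obtain rfl | hi := eq_or_ne i (Fin.last m)
  · have huniv : Finset.Iic (Fin.last m) = Finset.univ := Finset.Iic_top
    rw [Fin.last_add_one, huniv]
    have hIio : Finset.Iio (0 : Fin (m + 1)) = ∅ := Finset.Iio_bot
    rw [hIio, Finset.sum_empty]
    exact (Nat.modEq_zero_iff_dvd.2 h).symm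
  · have hIio : Finset.Iio (i + 1) = Finset.Iic i := by
      ext j
      simp only [Finset.mem_Iio, Finset.mem_Iic, Fin.lt_def, Fin.le_def,
        Fin.val_add_one_of_lt (Fin.lt_last_iff_ne_last.2 hi), Order.lt_add_one_iff]
    rw [hIio]

variable {m n k : ℕ} {κ : Fin (2 * m + 3) → ℕ}

theorem cycleGraph_adj_succ (i : Fin (2 * m + 3)) : (cycleGraph (2 * m + 3)).Adj i (i + 1) := by
  simp [cycleGraph_adj]

theorem card_le_of_isIndepSet_cycleGraph {T : Finset (Fin (2 * m + 3))}
    (hT : (cycleGraph (2 * m + 3)).IsIndepSet T) : T.card ≤ m + 1 := by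
  let χ (i : Fin (2 * m + 3)) : ℕ := if i ∈ T then 1 else 0
  have hpair (i : Fin (2 * m + 3)) : χ i + χ (i + 1) ≤ 1 := by
    have : ¬ (i ∈ T ∧ i + 1 ∈ T) := fun ⟨h, h'⟩ =>
      hT h h' (cycleGraph_adj_succ i).ne (cycleGraph_adj_succ i)
    simp only [χ]
    split_ifs <;> simp_all
  have hcard : ∑ i, χ i = T.card := by simp [χ]
  have hshift : ∑ i, χ (i + 1) = T.card := hcard ▸ Equiv.sum_comp (Equiv.addRight 1) χ
  have hsum : ∑ i, (χ i + χ (i + 1)) ≤ ∑ _i : Fin (2 * m + 3), 1 :=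
    Finset.sum_le_sum fun i _ => hpair i
  rw [Finset.sum_add_distrib, hcard, hshift, Finset.sum_const, Finset.card_univ,
    Fintype.card_fin, smul_eq_mul] at hsum
  omega

theorem sum_le_of_weightColorable_cycleGraph
    (h : WeightColorable (cycleGraph (2 * m + 3)) κ n) : ∑ i, κ i ≤ (m + 1) * n := by
  obtain ⟨C, hC, hd⟩ := h
  let T (x : Fin n) : Finset (Fin (2 * m + 3)) := {i | x ∈ C i}
  have hT (x : Fin n) : (T x).card ≤ m + 1 := by
    refine card_le_of_isIndepSet_cycleGraph fun i hi j hj _ hij => ?_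
    simp only [T, Finset.coe_filter, Finset.mem_univ, true_and, Set.mem_ofPred_eq] at hi hj
    exact Finset.disjoint_left.1 (hd i j hij) hi hj
  calc ∑ i, κ i ≤ ∑ i, (C i).card := Finset.sum_le_sum fun i _ => hC i
    _ = ∑ x, (T x).card := by
      simpa [Finset.bipartiteAbove, Finset.bipartiteBelow] using
        Finset.sum_card_bipartiteAbove_eq_sum_card_bipartiteBelow
          (s := Finset.univ) (t := Finset.univ) fun i x => x ∈ C i
    _ ≤ ∑ _x : Fin n, (m + 1) := Finset.sum_le_sum fun x _ => hT x
    _ = (m + 1) * n := by simp [mul_comm]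

theorem add_le_of_weightColorable {I : Type*} {Q : SimpleGraph I} {μ : I → ℕ} {i j : I}
    (h : WeightColorable Q μ n) (hij : Q.Adj i j) : μ i + μ j ≤ n := by
  obtain ⟨C, hC, hd⟩ := h
  calc μ i + μ j ≤ (C i).card + (C j).card := add_le_add (hC i) (hC j)
    _ = ((C i).disjUnion (C j) (hd i j hij)).card := (Finset.card_disjUnion ..).symm
    _ ≤ n := by simpa using Finset.card_le_univ ((C i).disjUnion (C j) (hd i j hij))

/-- The colors of the vertex `i` form an arc of length `κ i` on a circle of `n` colors, and the arc
of `i + 1` starts at distance `d i` after that of `i`. -/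
theorem weightColorable_cycleGraph_of_gaps {N : ℕ} {μ d : Fin (N + 2) → ℕ} (hn : 0 < n)
    (hμd : ∀ i, μ i ≤ d i) (hdn : ∀ i, d i + μ (i + 1) ≤ n) (hd : n ∣ ∑ i, d i) :
    WeightColorable (cycleGraph (N + 2)) μ n := by
  obtain ⟨s, hs⟩ := exists_forall_succ_modEq_add hd
  let arc (i : Fin (N + 2)) : Finset (Fin n) :=
    (Finset.range (μ i)).image fun a => ⟨(s i + a) % n, Nat.mod_lt _ hn⟩
  have hdisj (i) : Disjoint (arc i) (arc (i + 1)) := by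
    simp only [arc, Finset.disjoint_left, Finset.mem_image, Finset.mem_range]
    rintro _ ⟨a, ha, rfl⟩ ⟨b, hb, hab⟩
    have hmod : d i + b ≡ a [MOD n] := Nat.ModEq.add_left_cancel' (s i) <| by
      rw [← add_assoc]
      exact ((hs i).symm.add_right b).trans (Fin.ext_iff.1 hab)
    have := hμd i
    have := hdn i
    have := hmod.eq_of_lt_of_lt (by omega) (by omega)
    omega
  refine ⟨arc, fun i => ?_, fun i j hij => ?_⟩
  · rw [Finset.card_image_of_injOn, Finset.card_range]
    intro a ha b hb hab
    simp only [Finset.coe_range, Set.mem_Iio] at ha hb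
    have := hμd i
    have := hdn i
    exact (Nat.ModEq.add_left_cancel' (s i) (Fin.ext_iff.1 hab)).eq_of_lt_of_lt
      (by omega) (by omega)
  · obtain h | h := cycleGraph_adj.1 hij
    · obtain rfl : i = j + 1 := by rw [← h, add_sub_cancel]
      exact (hdisj j).symm
    · obtain rfl : j = i + 1 := by rw [← h, add_sub_cancel]
      exact hdisj i

/-- Gaps `d i` between `κ i` and `n - κ (i + 1)` that go exactly `m + 1` times around the circle of
colors exist because the extreme choices go around at most and at least `m + 1` times. -/
theorem weightColorable_cycleGraph (hpair : ∀ i, κ i + κ (i + 1) ≤ n)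
    (hsum : ∑ i, κ i ≤ (m + 1) * n) : WeightColorable (cycleGraph (2 * m + 3)) κ n := by
  obtain rfl | hn := Nat.eq_zero_or_pos n
  · refine ⟨fun _ => ∅, fun i => ?_, fun _ _ _ => Finset.disjoint_empty_left _⟩
    exact (Nat.le_add_right _ _).trans (hpair i)
  have hle (i) : κ (i + 1) ≤ n := (Nat.le_add_left _ _).trans (hpair i)
  obtain ⟨d, hκd, hdn, hd⟩ : ∃ d : Fin (2 * m + 3) → ℕ, κ ≤ d ∧ (d ≤ fun i => n - κ (i + 1)) ∧
      ∑ i, d i = (m + 1) * n := by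
    refine exists_sum_eq (fun i => Nat.le_sub_of_add_le (hpair i)) hsum ?_
    have hshift : ∑ i, κ (i + 1) = ∑ i, κ i := Equiv.sum_comp (Equiv.addRight 1) κ
    have hsub : ∑ i, (n - κ (i + 1)) + ∑ i, κ (i + 1) = (2 * m + 3) * n := by
      simp [← Finset.sum_add_distrib, Nat.sub_add_cancel (hle _)]
    nlinarith
  exact weightColorable_cycleGraph_of_gaps hn hκd
    (fun i => Nat.add_le_of_le_sub (hle i) (hdn i)) (hd ▸ Dvd.intro_left _ rfl)

theorem weightColorable_cycleGraph_iff : WeightColorable (cycleGraph (2 * m + 3)) κ n ↔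
    (∀ i, κ i + κ (i + 1) ≤ n) ∧ ∑ i, κ i ≤ (m + 1) * n :=
  ⟨fun h => ⟨fun i => add_le_of_weightColorable h (cycleGraph_adj_succ i),
    sum_le_of_weightColorable_cycleGraph h⟩, fun h => weightColorable_cycleGraph h.1 h.2⟩

theorem weightCritical_cycleGraph_iff (hκ : ∀ i, 0 < κ i) :
    WeightCritical (cycleGraph (2 * m + 3)) κ k ↔
      (∀ i, κ i + κ (i + 1) ≤ k - 1) ∧ ∑ i, κ i = (m + 1) * (k - 1) + 1 := by
  have hpos : 0 < ∑ i, κ i := Finset.sum_pos (fun i _ => hκ i) Finset.univ_nonempty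
  simp only [WeightCritical, weightColorable_cycleGraph_iff, sum_update_sub_one (hκ _)]
  constructor
  · rintro ⟨hnot, hdel⟩
    have hpair (i) : κ i + κ (i + 1) ≤ k - 1 := by
      obtain ⟨j, hj⟩ : ∃ j, j ∉ ({i, i + 1} : Finset (Fin (2 * m + 3))) := by
        by_contra! h
        have huniv := (Finset.card_eq_iff_eq_univ _).2 (Finset.eq_univ_of_forall h)
        have htwo := Finset.card_le_two (a := i) (b := i + 1)
        rw [huniv, Fintype.card_fin] at htwo
        omega
      simp only [Finset.mem_insert, Finset.mem_singleton, not_or] at hj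
      have := (hdel j).1 i
      rwa [Function.update_of_ne (Ne.symm hj.1), Function.update_of_ne (Ne.symm hj.2)] at this
    have hlt : (m + 1) * (k - 1) < ∑ i, κ i := not_le.1 fun h => hnot ⟨hpair, h⟩
    have := (hdel 0).2
    exact ⟨hpair, by omega⟩
  · rintro ⟨hpair, hsum⟩
    refine ⟨fun h => by omega, fun i => ⟨fun j => le_trans ?_ (hpair j), by omega⟩⟩
    have hle : Function.update κ i (κ i - 1) ≤ κ := update_le_self_iff.2 (Nat.sub_le _ _)
    exact add_le_add (hle j) (hle (j + 1))

end OddCycle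

/-! ### Modules, prime graphs and quotients -/

section Module

variable {V W : Type*} {G : SimpleGraph V} {P : SimpleGraph W} {S : Set V}

/-- A module (homogeneous set) of a graph: no vertex outside `S` distinguishes two vertices
of `S`. -/
def IsModule (G : SimpleGraph V) (S : Set V) : Prop :=
  ∀ x ∉ S, ∀ a ∈ S, ∀ b ∈ S, G.Adj x a ↔ G.Adj x b

/-- A graph is prime if its only modules are the trivial ones: the empty set, the singletons and the
whole vertex set. -/
def IsPrime (G : SimpleGraph V) : Prop :=
  ∀ S, IsModule G S → S.Subsingleton ∨ S = Set.univ

theorem isModule_compl_iff : IsModule Gᶜ S ↔ IsModule G S := by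
  refine forall₂_congr fun x hx => forall₂_congr fun a ha => forall₂_congr fun b hb => ?_
  have hxa : x ≠ a := fun h => hx (h ▸ ha)
  have hxb : x ≠ b := fun h => hx (h ▸ hb)
  rw [compl_adj, compl_adj, and_iff_right hxa, and_iff_right hxb, not_iff_not]

theorem IsPrime.compl (h : IsPrime G) : IsPrime Gᶜ :=
  fun S hS => h S (isModule_compl_iff.1 hS)

theorem isPrime_iff_finset [Finite V] :
    IsPrime G ↔ ∀ S : Finset V, IsModule G S → S.card ≤ 1 ∨ ∀ x, x ∈ S := by
  refine ⟨fun h S hS => (h S hS).imp (fun h' => ?_) fun h' => ?_, fun h S hS => ?_⟩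
  · exact Finset.card_le_one.2 h'
  · simpa [Set.eq_univ_iff_forall] using h'
  · lift S to Finset V using S.toFinite
    exact (h S hS).imp (fun h' => Finset.card_le_one.1 h') fun h' => by
      simpa [Set.eq_univ_iff_forall] using h'

theorem isPrime_cycleGraph_five : IsPrime (cycleGraph 5) := by
  simp only [isPrime_iff_finset, IsModule, Finset.mem_coe]
  decide

theorem isPrime_pathGraph_five : IsPrime (pathGraph 5) := by
  let : DecidableRel (pathGraph 5).Adj := fun _ _ => decidable_of_iff _ pathGraph_adj.symm
  simp only [isPrime_iff_finset, IsModule, Finset.mem_coe]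
  decide

/-- Two vertices with the same image form a module of `P`. -/
theorem IsPrime.isIndContained_of_adj_iff (hP : IsPrime P) (hW : ∀ i j : W, ∃ w, w ≠ i ∧ w ≠ j)
    (g : W → V) (hg : ∀ i j, G.Adj (g i) (g j) ↔ P.Adj i j) : P ⊴ G := by
  refine ⟨⟨⟨g, fun i j hij => ?_⟩, fun {i j} => hg i j⟩⟩
  have hmod : IsModule P {i, j} := by
    have h (x : W) (a) (ha : a ∈ ({i, j} : Set W)) : P.Adj x a ↔ G.Adj (g x) (g i) := by
      obtain rfl | rfl := ha
      · exact (hg x a).symm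
      · rw [hij, hg]
    exact fun x _ a ha b hb => (h x a ha).trans (h x b hb).symm
  refine (hP _ hmod).elim (fun h => h (by simp) (by simp)) fun h => ?_
  obtain ⟨w, hwi, hwj⟩ := hW i j
  simpa [hwi, hwj] using h.symm.subset (Set.mem_univ w)

end Module

section FiveVertices

variable {V : Type*} {G : SimpleGraph V} {a b c d e : V}

theorem pathGraph_five_isIndContained (hab : G.Adj a b) (hbc : G.Adj b c) (hcd : G.Adj c d)
    (hde : G.Adj d e) (hac : ¬ G.Adj a c) (had : ¬ G.Adj a d) (hae : ¬ G.Adj a e)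
    (hbd : ¬ G.Adj b d) (hbe : ¬ G.Adj b e) (hce : ¬ G.Adj c e) : pathGraph 5 ⊴ G := by
  refine isPrime_pathGraph_five.isIndContained_of_adj_iff (by decide) ![a, b, c, d, e] fun i j => ?_
  rw [pathGraph_adj]
  fin_cases i <;> fin_cases j <;> simp [*, G.adj_comm]

theorem compl_pathGraph_five_isIndContained (hab : ¬ G.Adj a b) (hbc : ¬ G.Adj b c)
    (hcd : ¬ G.Adj c d) (hde : ¬ G.Adj d e) (hac : G.Adj a c) (had : G.Adj a d) (hae : G.Adj a e)
    (hbd : G.Adj b d) (hbe : G.Adj b e) (hce : G.Adj c e) : (pathGraph 5)ᶜ ⊴ G := by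
  have hne : a ≠ b ∧ b ≠ c ∧ c ≠ d ∧ d ≠ e := by
    refine ⟨?_, ?_, ?_, ?_⟩ <;> rintro rfl <;> contradiction
  rw [← compl_isIndContained_compl, compl_compl]
  apply pathGraph_five_isIndContained (a := a) (b := b) (c := c) (d := d) (e := e) <;>
    simp [*]

theorem cycleGraph_five_isIndContained (hab : G.Adj a b) (hbc : G.Adj b c) (hcd : G.Adj c d)
    (hde : G.Adj d e) (hea : G.Adj e a) (hac : ¬ G.Adj a c) (had : ¬ G.Adj a d)
    (hbd : ¬ G.Adj b d) (hbe : ¬ G.Adj b e) (hce : ¬ G.Adj c e) : cycleGraph 5 ⊴ G := by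
  refine isPrime_cycleGraph_five.isIndContained_of_adj_iff (by decide) ![a, b, c, d, e]
    fun i j => ?_
  have hadj : ∀ i j : Fin 5, (cycleGraph 5).Adj i j ↔
      (i.val + 1) % 5 = j.val ∨ (j.val + 1) % 5 = i.val := by decide
  rw [hadj]
  fin_cases i <;> fin_cases j <;> simp [*, hea.symm, G.adj_comm]

end FiveVertices

section Quotient

variable {V : Type u} {I J : Type*} {G : SimpleGraph V} {Q : SimpleGraph I} {R : SimpleGraph J}

/-- `Q` is a quotient of `G` by a modular partition, which is given by its projection `f`: the
fibers of `f` are nonempty and vertices in different fibers are adjacent in `G` exactly when their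
images are adjacent in `Q`. -/
def HasQuotient (G : SimpleGraph V) (Q : SimpleGraph I) : Prop :=
  ∃ f : V → I, Function.Surjective f ∧ ∀ u v, f u ≠ f v → (G.Adj u v ↔ Q.Adj (f u) (f v))

theorem hasQuotient_of_iso (e : G ≃g Q) : HasQuotient G Q :=
  ⟨e, e.surjective, fun _ _ _ => e.map_rel_iff.symm⟩

theorem hasQuotient_substitute {W : I → Type*} [∀ i, Nonempty (W i)] (B : ∀ i, SimpleGraph (W i)) :
    HasQuotient (Q.substitute B) Q :=
  ⟨Sigma.fst, Sigma.fst_surjective, fun _ _ huv => substitute_adj_of_ne huv⟩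

theorem HasQuotient.trans (h : HasQuotient G Q) (h' : HasQuotient Q R) : HasQuotient G R := by
  obtain ⟨f, hf, hadj⟩ := h
  obtain ⟨g, hg, hadj'⟩ := h'
  exact ⟨g ∘ f, hg.comp hf, fun u v huv =>
    (hadj u v fun h => huv (congrArg g h)).trans (hadj' _ _ huv)⟩

theorem HasQuotient.isIndContained (h : HasQuotient G Q) : Q ⊴ G := by
  obtain ⟨f, hf, hadj⟩ := h
  choose g hg using hf
  refine ⟨⟨⟨g, Function.LeftInverse.injective hg⟩, fun {i j} => ?_⟩⟩
  obtain rfl | hij := eq_or_ne i j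
  · simp
  · simpa [hg] using hadj (g i) (g j) (by simpa [hg] using hij)

theorem hasQuotient_iff_nonempty_iso_substitute :
    HasQuotient G Q ↔ ∃ (W : I → Type u) (B : ∀ i, SimpleGraph (W i)),
      (∀ i, Nonempty (W i)) ∧ Nonempty (G ≃g Q.substitute B) := by
  constructor
  · rintro ⟨f, hf, hadj⟩
    refine ⟨fun i => f ⁻¹' {i}, fun i => G.induce (f ⁻¹' {i}), fun i => ?_,
      ⟨RelIso.symm ⟨Equiv.sigmaFiberEquiv f, fun {x y} => ?_⟩⟩⟩
    · obtain ⟨v, hv⟩ := hf i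
      exact ⟨v, hv⟩
    · obtain ⟨i, u, rfl⟩ := x
      obtain ⟨j, v, hv⟩ := y
      by_cases hij : f u = j
      · subst hij
        exact (substitute_adj_same (B := fun i => G.induce (f ⁻¹' {i})) (a := ⟨u, rfl⟩)
          (b := ⟨v, hv⟩)).symm
      · subst hv
        exact (hadj u v hij).trans (substitute_adj_of_ne hij).symm
  · rintro ⟨W, B, hW, ⟨e⟩⟩
    exact (hasQuotient_of_iso e).trans (hasQuotient_substitute B)

theorem exists_hasQuotient_induce_of_isModule {S : Set V} (hS : IsModule G S) (hnt : S.Nontrivial)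
    (huniv : S ≠ Set.univ) :
    ∃ T : Set V, T.Nontrivial ∧ T ≠ Set.univ ∧ HasQuotient G (G.induce T) := by
  classical
  obtain ⟨s, hs, t, ht, hst⟩ := hnt
  obtain ⟨x, hx⟩ := (Set.ne_univ_iff_exists_notMem S).1 huniv
  have hsx : s ≠ x := fun h => hx (h ▸ hs)
  let f (v : V) : (insert s Sᶜ : Set V) := if h : v ∈ S then ⟨s, .inl rfl⟩ else ⟨v, .inr h⟩
  have hfS {v : V} (hv : v ∈ S) : (f v : V) = s := by simp [f, hv]
  have hfS' {v : V} (hv : v ∉ S) : (f v : V) = v := by simp [f, hv]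
  refine ⟨insert s Sᶜ, ⟨s, .inl rfl, x, .inr hx, hsx⟩, fun h => ?_, f, ?_, fun u v huv => ?_⟩
  · simpa [hst.symm, ht] using h.symm.subset (Set.mem_univ t)
  · rintro ⟨v, rfl | hv⟩
    · exact ⟨v, Subtype.ext (hfS hs)⟩
    · exact ⟨v, Subtype.ext (hfS' hv)⟩
  · rw [comap_adj, Function.Embedding.subtype_apply, Function.Embedding.subtype_apply]
    by_cases hu : u ∈ S <;> by_cases hv : v ∈ S
    · exact absurd (Subtype.ext ((hfS hu).trans (hfS hv).symm)) huv
    · rw [hfS hu, hfS' hv, G.adj_comm, hS v hv u hu s hs, G.adj_comm]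
    · rw [hfS' hu, hfS hv, hS u hu v hv s hs]
    · rw [hfS' hu, hfS' hv]

theorem exists_isPrime_hasQuotient [Finite V] [Nontrivial V] (G : SimpleGraph V) :
    ∃ (I : Type u) (_ : Finite I) (_ : Nontrivial I) (Q : SimpleGraph I),
      IsPrime Q ∧ HasQuotient G Q := by
  induction h : Nat.card V using Nat.strong_induction_on generalizing V with
  | _ n ih =>
    by_cases hG : IsPrime G
    · exact ⟨V, ‹_›, ‹_›, G, hG, hasQuotient_of_iso .refl⟩
    simp only [IsPrime, not_forall, not_or, Set.not_subsingleton_iff] at hG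
    obtain ⟨S, hS, hnt, huniv⟩ := hG
    obtain ⟨T, hT, hTuniv, hGT⟩ := exists_hasQuotient_induce_of_isModule hS hnt huniv
    have := hT.coe_sort
    obtain ⟨x, hx⟩ := (Set.ne_univ_iff_exists_notMem T).1 hTuniv
    have hlt : Nat.card T < n := h ▸ Finite.card_subtype_lt hx
    obtain ⟨I, hI, hI', Q, hQ, hTQ⟩ := ih _ hlt (G.induce T) rfl
    exact ⟨I, hI, hI', Q, hQ, hGT.trans hTQ⟩

end Quotient

section Substitute

variable {I : Type*} {W : I → Type*} {Q : SimpleGraph I} {B : ∀ i, SimpleGraph (W i)}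

theorem bag_isIndContained_substitute (i : I) : B i ⊴ Q.substitute B :=
  ⟨⟨⟨Sigma.mk i, sigma_mk_injective⟩, substitute_adj_same⟩⟩

theorem isModule_preimage_fst {U : Type*} {P : SimpleGraph U} (φ : P ↪g Q.substitute B) (i : I) :
    IsModule P {p | (φ p).1 = i} := by
  have hadj {x a : U} (hx : (φ x).1 ≠ i) (ha : (φ a).1 = i) : P.Adj x a ↔ Q.Adj (φ x).1 i := by
    rw [← φ.map_rel_iff, ← ha]
    exact substitute_adj_of_ne (ha ▸ hx)
  exact fun x hx a ha b hb => (hadj hx ha).trans (hadj hx hb).symm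

theorem IsPrime.isIndContained_substitute_iff [∀ i, Nonempty (W i)] {U : Type*}
    {P : SimpleGraph U} (hP : IsPrime P) : P ⊴ Q.substitute B ↔ P ⊴ Q ∨ ∃ i, P ⊴ B i := by
  refine ⟨fun ⟨φ⟩ => ?_, fun h => h.elim (·.trans (hasQuotient_substitute B).isIndContained)
    fun ⟨i, hi⟩ => hi.trans (bag_isIndContained_substitute i)⟩
  by_cases hinj : Function.Injective fun p => (φ p).1
  · refine .inl ⟨⟨⟨_, hinj⟩, fun {p q} => ?_⟩⟩
    obtain rfl | hpq := eq_or_ne p q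
    · simp
    · exact (substitute_adj_of_ne (hinj.ne hpq)).symm.trans φ.map_rel_iff
  · obtain ⟨p, q, hpq, hne⟩ := Function.not_injective_iff.1 hinj
    have huniv := (hP _ (isModule_preimage_fst φ (φ q).1)).resolve_left fun h => hne (h hpq rfl)
    obtain ⟨i, hi⟩ : ∃ i, ∀ p, (φ p).1 = i := ⟨_, Set.eq_univ_iff_forall.1 huniv⟩
    have hfiber (p) : ∃ a, φ p = ⟨i, a⟩ := by
      specialize hi p
      generalize φ p = x at hi
      obtain ⟨j, a⟩ := x
      obtain rfl : j = i := hi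
      exact ⟨a, rfl⟩
    choose a ha using hfiber
    refine .inr ⟨i, ⟨⟨⟨a, fun p q h => φ.injective ?_⟩, fun {p q} => ?_⟩⟩⟩
    · rw [ha, ha, h]
    · rw [← φ.map_rel_iff, ha, ha]
      exact substitute_adj_same.symm

end Substitute

section Free

variable {V W : Type*} {G : SimpleGraph V} {H : SimpleGraph W}

theorem isP5CoP5Free_of_isIndContained (h : H ⊴ G) (hG : G.IsP5CoP5Free) : H.IsP5CoP5Free :=
  ⟨fun h' => hG.1 (h'.trans h), fun h' => hG.2 (h'.trans h)⟩

theorem isP5CoP5Free_substitute_iff {I : Type*} {W : I → Type*} [∀ i, Nonempty (W i)]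
    {Q : SimpleGraph I} {B : ∀ i, SimpleGraph (W i)} :
    (Q.substitute B).IsP5CoP5Free ↔ Q.IsP5CoP5Free ∧ ∀ i, (B i).IsP5CoP5Free := by
  simp only [IsP5CoP5Free, isPrime_pathGraph_five.isIndContained_substitute_iff,
    isPrime_pathGraph_five.compl.isIndContained_substitute_iff, not_or, not_exists, forall_and]
  exact and_and_and_comm

theorem isP5CoP5Free_top : (⊤ : SimpleGraph V).IsP5CoP5Free := by
  constructor <;> intro h <;>
    have h := congrFun₂ (congrArg Adj (eq_top_of_isIndContained_top h))
  · simpa [pathGraph_adj] using h 0 2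
  · simpa [pathGraph_adj] using h 0 1

theorem isP5CoP5Free_cycleGraph_five : (cycleGraph 5).IsP5CoP5Free := by
  have hindep : ∀ x y z : Fin 5, x ≠ y → x ≠ z → y ≠ z →
      (cycleGraph 5).Adj x y ∨ (cycleGraph 5).Adj x z ∨ (cycleGraph 5).Adj y z := by decide
  have hclique : ∀ x y z : Fin 5,
      ¬ ((cycleGraph 5).Adj x y ∧ (cycleGraph 5).Adj x z ∧ (cycleGraph 5).Adj y z) := by decide
  constructor <;> rintro ⟨φ⟩
  · have h := hindep (φ 0) (φ 2) (φ 4) (φ.injective.ne (by decide)) (φ.injective.ne (by decide))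
      (φ.injective.ne (by decide))
    simp only [φ.map_adj_iff] at h
    simp [pathGraph_adj] at h
  · have h := hclique (φ 0) (φ 2) (φ 4)
    simp only [φ.map_adj_iff] at h
    simp [pathGraph_adj] at h

end Free

/-! ### Perfect orders -/

section PerfectOrder

theorem exists_kernel {α : Type*} {r : α → α → Prop} (hr : WellFounded r) :
    ∃ S : Set α, ∀ a, a ∈ S ↔ ∀ b, r b a → b ∉ S :=
  ⟨{a | hr.fix (C := fun _ => Prop) (fun a ih => ∀ b (h : r b a), ¬ ih b h) a},
    fun _ => iff_of_eq (hr.fix_eq _ _)⟩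

/-- A perfect order in the sense of Chvátal: no induced path `a b c d` has `a` before `b` and `d`
before `c`. -/
def IsPerfectlyOrdered {V : Type*} [LinearOrder V] (G : SimpleGraph V) : Prop :=
  ∀ ⦃a b c d⦄, G.Adj a b → G.Adj b c → G.Adj c d → ¬ G.Adj a c → ¬ G.Adj a d → ¬ G.Adj b d →
    a < b → ¬ d < c

variable {V : Type*} [LinearOrder V] {G : SimpleGraph V} {S : Set V}

theorem IsPerfectlyOrdered.induce (hG : IsPerfectlyOrdered G) (S : Set V) :
    IsPerfectlyOrdered (G.induce S) :=
  fun _ _ _ _ hab hbc hcd hac had hbd hlt => hG hab hbc hcd hac had hbd hlt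

theorem IsPerfectlyOrdered.exists_forall_adj (hG : IsPerfectlyOrdered G) (hS : G.IsIndepSet S)
    {C : Finset V} (hC : G.IsClique C) (hne : C.Nonempty) {p : V → V}
    (hp : ∀ w ∈ C, p w ∈ S ∧ p w < w ∧ G.Adj (p w) w) : ∃ w ∈ C, ∀ u ∈ C, G.Adj (p w) u := by
  classical
  induction C using Finset.strongInduction with
  | H C ih =>
    obtain ⟨w₀, hw₀, hmin⟩ := C.exists_min_image p hne
    by_cases hU : ∃ u ∈ C, ¬ G.Adj (p w₀) u
    · let U := C.filter fun u => ¬ G.Adj (p w₀) u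
      have hUC : U ⊆ C := C.filter_subset _
      obtain ⟨w, hw, hwU⟩ := ih U
        (Finset.filter_ssubset.2 ⟨w₀, hw₀, not_not.2 (hp w₀ hw₀).2.2⟩)
        (hC.subset (Finset.coe_subset.2 hUC)) (Finset.filter_nonempty_iff.2 hU)
        fun u hu => hp u (hUC hu)
      obtain ⟨hwC, hw₀w⟩ := Finset.mem_filter.1 hw
      refine ⟨w, hwC, fun u hu => ?_⟩
      by_contra hwu
      have huU : u ∉ U := fun h => hwu (hwU u h)
      have hw₀u : G.Adj (p w₀) u := by simpa [U, hu] using huU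
      have hS' : ¬ G.Adj (p w₀) (p w) := fun h => hS (hp _ hw₀).1 (hp _ hwC).1 h.ne h
      -- `p w₀`, `u`, `w`, `p w` is a path that is forbidden in a perfect order
      exact hG hw₀u (hC hu hwC (ne_of_mem_of_not_mem hw huU).symm) (hp w hwC).2.2.symm hw₀w hS'
        (fun h => hwu h.symm) ((hmin u hu).trans_lt (hp u hu).2.1) (hp w hwC).2.1
    · push Not at hU
      exact ⟨w₀, hw₀, hU⟩

theorem IsPerfectlyOrdered.colorable_of_cliqueFree [WellFoundedLT V] (hG : IsPerfectlyOrdered G)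
    {n : ℕ} (hn : G.CliqueFree (n + 1)) : G.Colorable n := by
  classical
  induction n generalizing V with
  | zero =>
    have : IsEmpty V := cliqueFree_one.1 hn
    exact .of_isEmpty 0
  | succ n ih =>
    have hwf : WellFounded fun u v => u < v ∧ G.Adj u v :=
      Subrelation.wf And.left (wellFounded_lt (α := V))
    obtain ⟨S, hS⟩ := exists_kernel hwf
    have hindep : G.IsIndepSet S := by
      intro u hu v hv huv hadj
      obtain hlt | hlt := huv.lt_or_gt
      · exact (hS v).1 hv u ⟨hlt, hadj⟩ hu
      · exact (hS u).1 hu v ⟨hlt, hadj.symm⟩ hv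
    refine colorable_succ_of_isIndepSet hindep (ih (hG.induce _) ?_)
    intro K hK
    let C := K.map (.subtype _)
    have hC : G.IsNClique (n + 1) C := (isNClique_induce_iff ..).1 hK
    have hdom : ∀ w ∈ C, ∃ p ∈ S, p < w ∧ G.Adj p w := by
      intro w hw
      obtain ⟨⟨w, hwS⟩, -, rfl⟩ := Finset.mem_map.1 hw
      have := mt (hS w).2 hwS
      push Not at this
      obtain ⟨p, hp, hpS⟩ := this
      exact ⟨p, hpS, hp⟩
    choose! p hp using hdom
    obtain ⟨w, -, hw⟩ := hG.exists_forall_adj hindep hC.isClique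
      (Finset.card_pos.1 (hC.card_eq ▸ n.succ_pos)) hp
    exact hn _ (hC.insert hw)

end PerfectOrder

section DegreeOrder

variable {V : Type*} {G : SimpleGraph V} {a b c d x : V}

theorem adj_or_adj_of_adj_left (hG : G.IsP5CoP5Free) (h5 : ¬ cycleGraph 5 ⊴ G) (hab : G.Adj a b)
    (hbc : G.Adj b c) (hcd : G.Adj c d) (hac : ¬ G.Adj a c) (had : ¬ G.Adj a d) (hbd : ¬ G.Adj b d)
    (hax : G.Adj a x) : G.Adj b x ∨ G.Adj c x := by
  by_contra! h
  have hxb := mt G.adj_symm h.1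
  have hxc := mt G.adj_symm h.2
  by_cases hdx : G.Adj d x
  · exact h5 (cycleGraph_five_isIndContained hax.symm hab hbc hcd hdx hxb hxc hac had hbd)
  · exact hG.1 (pathGraph_five_isIndContained hax.symm hab hbc hcd hxb hxc (mt G.adj_symm hdx)
      hac had hbd)

theorem adj_of_adj_left_of_adj_right (hG : G.IsP5CoP5Free) (h5 : ¬ cycleGraph 5 ⊴ G)
    (hab : G.Adj a b) (hbc : G.Adj b c) (hcd : G.Adj c d) (hac : ¬ G.Adj a c) (had : ¬ G.Adj a d)
    (hbd : ¬ G.Adj b d) (hax : G.Adj a x) (hdx : G.Adj d x) : G.Adj b x := by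
  by_contra hbx
  have hcx := (adj_or_adj_of_adj_left hG h5 hab hbc hcd hac had hbd hax).resolve_left hbx
  exact hG.2 (compl_pathGraph_five_isIndContained (mt G.adj_symm hbx) hbd (mt G.adj_symm had) hac
    hdx.symm hax.symm hcx.symm hab.symm hbc hcd.symm)

theorem degree_add_degree_lt [Fintype V] [DecidableRel G.Adj] (hG : G.IsP5CoP5Free)
    (h5 : ¬ cycleGraph 5 ⊴ G) (hab : G.Adj a b) (hbc : G.Adj b c) (hcd : G.Adj c d)
    (hac : ¬ G.Adj a c) (had : ¬ G.Adj a d) (hbd : ¬ G.Adj b d) :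
    G.degree a + G.degree d < G.degree b + G.degree c := by
  classical
  have hca := mt G.adj_symm hac
  have hda := mt G.adj_symm had
  have hdb := mt G.adj_symm hbd
  have hunion : G.neighborFinset a ∪ G.neighborFinset d ⊂
      G.neighborFinset b ∪ G.neighborFinset c := by
    refine Finset.ssubset_iff_subset_ne.2 ⟨fun x hx => ?_, fun h => ?_⟩
    · simp only [Finset.mem_union, mem_neighborFinset] at hx ⊢
      obtain hax | hdx := hx
      · exact adj_or_adj_of_adj_left hG h5 hab hbc hcd hac had hbd hax
      · exact (adj_or_adj_of_adj_left hG h5 hcd.symm hbc.symm hab.symm hdb hda hca hdx).symm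
    · simpa [hab.symm, hda] using (Finset.ext_iff.1 h a)
  have hinter : G.neighborFinset a ∩ G.neighborFinset d ⊆
      G.neighborFinset b ∩ G.neighborFinset c := by
    intro x hx
    simp only [Finset.mem_inter, mem_neighborFinset] at hx ⊢
    exact ⟨adj_of_adj_left_of_adj_right hG h5 hab hbc hcd hac had hbd hx.1 hx.2,
      adj_of_adj_left_of_adj_right hG h5 hcd.symm hbc.symm hab.symm hdb hda hca hx.2 hx.1⟩
  simp only [← card_neighborFinset_eq_degree]
  rw [← Finset.card_union_add_card_inter (G.neighborFinset a),
    ← Finset.card_union_add_card_inter (G.neighborFinset b)]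
  exact add_lt_add_of_lt_of_le (Finset.card_lt_card hunion) (Finset.card_le_card hinter)

theorem colorable_of_isP5CoP5Free_of_cliqueFree [Finite V] (hG : G.IsP5CoP5Free)
    (h5 : ¬ cycleGraph 5 ⊴ G) {n : ℕ} (hn : G.CliqueFree (n + 1)) : G.Colorable n := by
  classical
  have := Fintype.ofFinite V
  let rank (v : V) : ℕᵒᵈ ×ₗ Fin (Fintype.card V) :=
    toLex (.toDual (G.degree v), Fintype.equivFin V v)
  have hrank : Function.Injective rank := fun u v h =>
    (Fintype.equivFin V).injective (congrArg Prod.snd (congrArg ofLex h))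
  let : LinearOrder V := .lift' rank hrank
  have hdeg {u v : V} (h : u < v) : G.degree v ≤ G.degree u := by
    obtain h | h := Prod.Lex.lt_iff.1 (show rank u < rank v from h)
    · exact h.le
    · exact h.1.le
  refine IsPerfectlyOrdered.colorable_of_cliqueFree ?_ hn
  intro a b c d hab hbc hcd hac had hbd hlt hlt'
  have hlt_deg := degree_add_degree_lt hG h5 hab hbc hcd hac had hbd
  exact hlt_deg.not_ge (add_le_add (hdeg hlt) (hdeg hlt'))

theorem eq_top_of_isCritical_of_hasQuotient {I : Type*} [Finite I] {Q : SimpleGraph I} {k : ℕ}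
    (hk : 0 < k) (hG : G.IsCritical k) (hQ : Q.IsP5CoP5Free) (h5 : ¬ cycleGraph 5 ⊴ Q)
    (h : HasQuotient G Q) : Q = ⊤ := by
  classical
  obtain ⟨W, B, hW, ⟨e⟩⟩ := hasQuotient_iff_nonempty_iso_substitute.1 h
  obtain ⟨κ, hκ, -, hQκ⟩ := (isCritical_substitute_iff hk).1 (isCritical_of_iso hk e hG)
  have hne (i) : Nonempty (Fin (κ i)) := Fin.pos_iff_nonempty.1 (hκ i)
  let H := Q.substitute fun i => (⊤ : SimpleGraph (Fin (κ i)))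
  have hHQ : HasQuotient H Q := hasQuotient_substitute _
  have hH : H.IsCritical k := (isCritical_substitute_iff hk).2
    ⟨κ, hκ, fun i => by simpa using isCritical_top (V := Fin (κ i)), hQκ⟩
  have hHfree : H.IsP5CoP5Free := isP5CoP5Free_substitute_iff.2 ⟨hQ, fun _ => isP5CoP5Free_top⟩
  have hH5 : ¬ cycleGraph 5 ⊴ H := by
    rw [isPrime_cycleGraph_five.isIndContained_substitute_iff, not_or, not_exists]
    refine ⟨h5, fun i hi => ?_⟩
    have h02 := congrFun₂ (congrArg Adj (eq_top_of_isIndContained_top hi)) 0 2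
    exact absurd h02 (by decide)
  have hclique : ¬ H.CliqueFree k := fun h => ((isCritical_iff hk).1 hH).1 <|
    colorable_of_isP5CoP5Free_of_cliqueFree hHfree hH5 (by rwa [Nat.sub_add_cancel hk])
  have hHtop := eq_top_of_isCritical_of_not_cliqueFree hk hH hclique
  exact eq_top_of_isIndContained_top (hHtop ▸ hHQ.isIndContained)

end DegreeOrder

/-! ### Maximal buoys -/

section Projection

variable {V I : Type*} {G : SimpleGraph V} {Q : SimpleGraph I} {S : Set V} {g : V → I} {c : I → V}
  {x y : V} {i : I}

/-- The map `g` projects the subgraph of `G` induced on `S` onto its quotient `Q`. For `Q = C₅` this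
means that `S` induces a buoy, whose bags are the fibers of `g` on `S`. -/
def IsProjectionOn (G : SimpleGraph V) (Q : SimpleGraph I) (S : Set V) (g : V → I) : Prop :=
  Set.SurjOn g S Set.univ ∧ ∀ u ∈ S, ∀ v ∈ S, g u ≠ g v → (G.Adj u v ↔ Q.Adj (g u) (g v))

/-- The function `c` chooses one vertex of `S` in every fiber of `g`. -/
def IsTransversal (S : Set V) (g : V → I) (c : I → V) : Prop :=
  ∀ i, c i ∈ S ∧ g (c i) = i

theorem IsTransversal.update [DecidableEq I] (hc : IsTransversal S g c) (hy : y ∈ S) :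
    IsTransversal S g (Function.update c (g y) y) :=
  (Function.forall_update_iff c fun i v => v ∈ S ∧ g v = i).2 ⟨⟨hy, rfl⟩, fun i _ => hc i⟩

theorem IsProjectionOn.exists_isTransversal (h : IsProjectionOn G Q S g) :
    ∃ c, IsTransversal S g c := by
  choose c hc using fun i => h.1 (Set.mem_univ i)
  exact ⟨c, hc⟩

theorem IsProjectionOn.adj_iff_of_isTransversal (h : IsProjectionOn G Q S g)
    (hc : IsTransversal S g c) (i j : I) : G.Adj (c i) (c j) ↔ Q.Adj i j := by
  obtain rfl | hij := eq_or_ne i j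
  · simp
  · simpa [(hc i).2, (hc j).2, hij] using h.2 (c i) (hc i).1 (c j) (hc j).1

theorem IsProjectionOn.exists_isTransversal_adj_not_adj [Nontrivial I]
    (h : IsProjectionOn G Q S g) {a b : V} (ha : a ∈ S) (hb : b ∈ S) (hxa : G.Adj x a)
    (hxb : ¬ G.Adj x b) :
    ∃ c, IsTransversal S g c ∧ (∃ i, G.Adj x (c i)) ∧ ∃ i, ¬ G.Adj x (c i) := by
  classical
  obtain ⟨c, hc⟩ := h.exists_isTransversal
  have hca := hc.update ha
  by_cases hall : ∀ i, G.Adj x (Function.update c (g a) a i)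
  · obtain ⟨i, hi⟩ := exists_ne (g b)
    refine ⟨_, hca.update hb, ⟨i, ?_⟩, ⟨g b, by simpa using hxb⟩⟩
    rw [Function.update_of_ne hi]
    exact hall i
  · exact ⟨_, hca, ⟨g a, by simpa using hxa⟩, not_forall.1 hall⟩

theorem IsProjectionOn.insert [DecidableEq V] (h : IsProjectionOn G Q S g) (hx : x ∉ S)
    (hadj : ∀ y ∈ S, g y ≠ i → (G.Adj x y ↔ Q.Adj i (g y))) :
    IsProjectionOn G Q (insert x S) (Function.update g x i) := by
  have hg {y} (hy : y ∈ S) : Function.update g x i y = g y :=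
    Function.update_of_ne (ne_of_mem_of_not_mem hy hx) _ _
  refine ⟨fun j hj => ?_, ?_⟩
  · obtain ⟨y, hy, hyj⟩ := h.1 hj
    exact ⟨y, .inr hy, (hg hy).trans hyj⟩
  · rintro u (rfl | hu) v (rfl | hv) huv
    · exact absurd rfl huv
    · rw [Function.update_self, hg hv] at huv ⊢
      exact hadj v hv huv.symm
    · rw [Function.update_self, hg hu] at huv ⊢
      rw [G.adj_comm, Q.adj_comm]
      exact hadj u hu huv
    · rw [hg hu, hg hv] at huv ⊢
      exact h.2 u hu v hv huv

theorem exists_isProjectionOn_of_isIndContained [Nonempty I] (h : Q ⊴ G) :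
    ∃ S g, IsProjectionOn G Q S g := by
  obtain ⟨φ⟩ := h
  have hinv := Function.leftInverse_invFun φ.injective
  refine ⟨Set.range φ, Function.invFun φ, fun i _ => ⟨φ i, ⟨i, rfl⟩, hinv i⟩, ?_⟩
  rintro _ ⟨i, rfl⟩ _ ⟨j, rfl⟩ -
  rw [hinv, hinv]
  exact φ.map_adj_iff

end Projection

section Attachment

/-- The possible neighborhoods of a vertex `x` on an induced `C₅`, if there is neither an induced
`P₅` nor an induced co-`P₅`: everything, nothing, or, up to one vertex `i`, the neighborhood of `i`,
so that `x` can be added to the bag of `i`. -/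
def IsAttachment (p : Fin 5 → Bool) : Prop :=
  (∀ i, p i = true) ∨ (∀ i, p i = false) ∨ ∃ i, ∀ j ≠ i, p j = decide ((cycleGraph 5).Adj i j)

instance (p : Fin 5 → Bool) : Decidable (IsAttachment p) :=
  inferInstanceAs (Decidable (_ ∨ _ ∨ _))

theorem isAttachment_or (p : Fin 5 → Bool) : IsAttachment p ∨
    (∃ i, p i = true ∧ p (i + 1) = false ∧ p (i + 2) = false ∧ p (i + 3) = false) ∨
    ∃ i, p i = false ∧ p (i + 2) = true ∧ p (i + 4) = true ∧ p (i + 1) = true := by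
  revert p
  decide

theorem IsAttachment.eq_of_forall {p : Fin 5 → Bool} (hp : IsAttachment p) {i j : Fin 5}
    (hij : j ≠ i) (h : ∀ l, l ≠ j → l ≠ i → p l = decide ((cycleGraph 5).Adj i l)) :
    p j = decide ((cycleGraph 5).Adj i j) := by
  revert p i j
  decide

theorem cycleGraph_five_adj_add (i : Fin 5) :
    (cycleGraph 5).Adj i (i + 1) ∧ (cycleGraph 5).Adj (i + 1) (i + 2) ∧
    (cycleGraph 5).Adj (i + 2) (i + 3) ∧ (cycleGraph 5).Adj (i + 4) i ∧
    ¬ (cycleGraph 5).Adj i (i + 2) ∧ ¬ (cycleGraph 5).Adj i (i + 3) ∧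
    ¬ (cycleGraph 5).Adj (i + 1) (i + 3) ∧ ¬ (cycleGraph 5).Adj (i + 2) (i + 4) ∧
    ¬ (cycleGraph 5).Adj (i + 4) (i + 1) := by
  revert i
  decide

variable {V : Type*} {G : SimpleGraph V} {S : Set V} {g : V → Fin 5} {c : Fin 5 → V} {x : V}

theorem isAttachment_of_isP5CoP5Free [DecidableRel G.Adj] (hG : G.IsP5CoP5Free)
    (hc : ∀ i j, G.Adj (c i) (c j) ↔ (cycleGraph 5).Adj i j) (x : V) :
    IsAttachment fun i => decide (G.Adj x (c i)) := by
  refine (isAttachment_or _).resolve_right ?_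
  simp only [decide_eq_true_eq, decide_eq_false_iff_not]
  rintro (⟨i, h0, h1, h2, h3⟩ | ⟨i, h0, h2, h4, h1⟩) <;>
    have hi := cycleGraph_five_adj_add i <;>
    simp only [← hc] at hi <;>
    obtain ⟨h01, h12, h23, h40, h02, h03, h13, h24, h41⟩ := hi
  · exact hG.1 (pathGraph_five_isIndContained h0 h01 h12 h23 h1 h2 h3 h02 h03 h13)
  · exact hG.2 (compl_pathGraph_five_isIndContained h0 h02 h24 h41 h2 h4 h1 h40.symm h01
      h12.symm)

theorem IsProjectionOn.exists_forall_adj_iff (hG : G.IsP5CoP5Free)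
    (hS : IsProjectionOn G (cycleGraph 5) S g) {a b : V} (ha : a ∈ S) (hb : b ∈ S)
    (hxa : G.Adj x a) (hxb : ¬ G.Adj x b) :
    ∃ i, ∀ y ∈ S, g y ≠ i → (G.Adj x y ↔ (cycleGraph 5).Adj i (g y)) := by
  classical
  have hatt {c} (hc : IsTransversal S g c) : IsAttachment fun i => decide (G.Adj x (c i)) :=
    isAttachment_of_isP5CoP5Free hG (hS.adj_iff_of_isTransversal hc) x
  obtain ⟨c, hc, ⟨j, hj⟩, ⟨l, hl⟩⟩ := hS.exists_isTransversal_adj_not_adj ha hb hxa hxb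
  obtain ⟨i, hi⟩ : ∃ i, ∀ j ≠ i, (G.Adj x (c j) ↔ (cycleGraph 5).Adj i j) := by
    obtain h | h | ⟨i, h⟩ := hatt hc
    · exact absurd (of_decide_eq_true (h l)) hl
    · exact absurd hj (of_decide_eq_false (h j))
    · exact ⟨i, fun j hj => decide_eq_decide.1 (h j hj)⟩
  refine ⟨i, fun y hy hyi => ?_⟩
  have hdec := (hatt (hc.update hy)).eq_of_forall hyi fun l hly hli => by
    simpa [Function.update_of_ne hly] using hi l hli
  simpa using hdec

theorem isModule_of_maximal_isProjectionOn (hG : G.IsP5CoP5Free)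
    (hS : Maximal (fun S => ∃ g, IsProjectionOn G (cycleGraph 5) S g) S) : IsModule G S := by
  classical
  obtain ⟨g, hg⟩ := hS.prop
  intro x hx
  have hadj : ∀ a ∈ S, ∀ b ∈ S, G.Adj x a → G.Adj x b := by
    intro a ha b hb hxa
    by_contra hxb
    obtain ⟨i, hi⟩ := hg.exists_forall_adj_iff hG ha hb hxa hxb
    exact hx (hS.le_of_ge ⟨_, hg.insert hx hi⟩ (Set.subset_insert x S) (Set.mem_insert x S))
  exact fun a ha b hb => ⟨hadj a ha b hb, hadj b hb a ha⟩

theorem IsPrime.hasQuotient_cycleGraph_five [Finite V] (hG : IsPrime G) (hfree : G.IsP5CoP5Free)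
    (h5 : cycleGraph 5 ⊴ G) : HasQuotient G (cycleGraph 5) := by
  obtain ⟨S, hS⟩ := (Set.toFinite {S | ∃ g, IsProjectionOn G (cycleGraph 5) S g}).exists_maximal
    (exists_isProjectionOn_of_isIndContained h5)
  obtain ⟨g, hsurj, hadj⟩ := hS.prop
  obtain hsub | rfl := hG S (isModule_of_maximal_isProjectionOn hfree hS)
  · obtain ⟨u, hu, hu0⟩ := hsurj (Set.mem_univ 0)
    obtain ⟨v, hv, hv1⟩ := hsurj (Set.mem_univ 1)
    exact absurd (hu0.symm.trans ((congrArg g (hsub hu hv)).trans hv1)) (by decide)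
  · exact ⟨g, Set.surjOn_univ.1 hsurj,
      fun u v => hadj u (Set.mem_univ u) v (Set.mem_univ v)⟩

end Attachment

/-! ### The two constructions -/

section Constructions

variable {V : Type u} {G : SimpleGraph V} {I : Type*} {Q : SimpleGraph I} {k : ℕ}

theorem memC_of_iso {W : Type*} {H : SimpleGraph W} (hk : 0 < k) (e : G ≃g H) (hG : G.MemC k) :
    H.MemC k :=
  ⟨isCritical_of_iso hk e hG.1, isP5CoP5Free_of_isIndContained e.symm.isIndContained hG.2⟩

theorem memC_substitute_iff [DecidableEq I] {W : I → Type*} [∀ i, Nonempty (W i)]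
    {B : ∀ i, SimpleGraph (W i)} (hk : 0 < k) (hQ : Q.IsP5CoP5Free) :
    (Q.substitute B).MemC k ↔
      ∃ κ, (∀ i, 0 < κ i) ∧ (∀ i, (B i).MemC (κ i)) ∧ WeightCritical Q κ k := by
  simp only [MemC, isCritical_substitute_iff hk, isP5CoP5Free_substitute_iff, hQ, true_and,
    forall_and]
  constructor
  · rintro ⟨⟨κ, hκ, hB, hQκ⟩, hfree⟩
    exact ⟨κ, hκ, ⟨hB, hfree⟩, hQκ⟩
  · rintro ⟨κ, hκ, ⟨hB, hfree⟩, hQκ⟩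
    exact ⟨⟨κ, hκ, hB, hQκ⟩, hfree⟩

theorem memC_and_hasQuotient_iff [DecidableEq I] (hk : 0 < k) (hQ : Q.IsP5CoP5Free) :
    G.MemC k ∧ HasQuotient G Q ↔
      ∃ (κ : I → ℕ) (W : I → Type u) (B : ∀ i, SimpleGraph (W i)),
        (∀ i, 0 < κ i) ∧ WeightCritical Q κ k ∧ (∀ i, (B i).MemC (κ i)) ∧
          Nonempty (G ≃g Q.substitute B) := by
  rw [hasQuotient_iff_nonempty_iso_substitute]
  constructor
  · rintro ⟨hG, W, B, hW, ⟨e⟩⟩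
    obtain ⟨κ, hκ, hB, hQκ⟩ := (memC_substitute_iff hk hQ).1 (memC_of_iso hk e hG)
    exact ⟨κ, W, B, hκ, hQκ, hB, ⟨e⟩⟩
  · rintro ⟨κ, W, B, hκ, hQκ, hB, ⟨e⟩⟩
    have hW (i) : Nonempty (W i) := nonempty_of_isCritical (hκ i) (hB i).1
    exact ⟨memC_of_iso hk e.symm ((memC_substitute_iff hk hQ).2 ⟨κ, hκ, hB, hQκ⟩),
      W, B, hW, ⟨e⟩⟩

/-- The join is the substitution into the complete graph on two vertices. -/
def substituteTopBoolIso {W : Bool → Type*} (B : ∀ i, SimpleGraph (W i)) :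
    (⊤ : SimpleGraph Bool).substitute B ≃g (B false).joinGraph (B true) where
  toFun
    | ⟨false, a⟩ => .inl a
    | ⟨true, a⟩ => .inr a
  invFun := Sum.elim (Sigma.mk false) (Sigma.mk true)
  left_inv := by rintro ⟨_ | _, a⟩ <;> rfl
  right_inv := by rintro (a | a) <;> rfl
  map_rel_iff' := by
    rintro ⟨_ | _, a⟩ ⟨_ | _, b⟩
    · exact (substitute_adj_same (B := B)).symm
    · exact iff_of_true trivial (.inl Bool.false_ne_true)
    · exact iff_of_true trivial (.inl Bool.false_ne_true.symm)
    · exact (substitute_adj_same (B := B)).symm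

theorem isConstruction1_iff (hk : 0 < k) :
    G.IsConstruction1 k ↔ G.MemC k ∧ HasQuotient G (⊤ : SimpleGraph Bool) := by
  rw [memC_and_hasQuotient_iff hk isP5CoP5Free_top]
  constructor
  · rintro ⟨k₁, k₂, V₁, V₂, G₁, G₂, hk₁, hk₂, hsum, hG₁, hG₂, ⟨e⟩⟩
    let κ : Bool → ℕ := fun b => cond b k₂ k₁
    let B : ∀ b, SimpleGraph (cond b V₂ V₁) := fun b => b.rec G₁ G₂
    have hκ : ∀ b, 0 < κ b := Bool.forall_bool.2 ⟨hk₁, hk₂⟩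
    have hB : ∀ b, (B b).MemC (κ b) := Bool.forall_bool.2 ⟨hG₁, hG₂⟩
    refine ⟨κ, _, B, hκ, ?_, hB, ⟨e.trans (substituteTopBoolIso B).symm⟩⟩
    rw [weightCritical_top_iff hκ hk, Fintype.sum_bool, add_comm]
    exact hsum
  · rintro ⟨κ, W, B, hκ, hQκ, hB, ⟨e⟩⟩
    rw [weightCritical_top_iff hκ hk, Fintype.sum_bool, add_comm] at hQκ
    exact ⟨_, _, _, _, _, _, hκ false, hκ true, hQκ, hB false, hB true,
      ⟨e.trans (substituteTopBoolIso B)⟩⟩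

theorem isConstruction2_iff (hk : 0 < k) :
    G.IsConstruction2 k ↔ G.MemC k ∧ HasQuotient G (cycleGraph 5) := by
  rw [memC_and_hasQuotient_iff hk isP5CoP5Free_cycleGraph_five]
  refine exists_congr fun κ => exists₂_congr fun W B => ?_
  have hsum : 2 * k - 1 = (1 + 1) * (k - 1) + 1 := by omega
  rw [hsum, ← and_assoc (b := _ = _)]
  exact and_congr_right fun hκ => and_congr_left' (weightCritical_cycleGraph_iff (m := 1) hκ).symm

end Constructions

theorem hasQuotient_top_bool {I : Type*} [Nontrivial I] :
    HasQuotient (⊤ : SimpleGraph I) (⊤ : SimpleGraph Bool) := by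
  classical
  obtain ⟨x, y, hxy⟩ := exists_pair_ne I
  exact ⟨fun i => decide (i = x), Bool.forall_bool.2 ⟨⟨y, by simp [hxy.symm]⟩, ⟨x, by simp⟩⟩,
    fun u v huv => iff_of_true (fun h => huv (h ▸ rfl)) huv⟩

theorem hasQuotient_top_bool_or_cycleGraph_five {V : Type*} {G : SimpleGraph V} {k : ℕ}
    (hk : 2 ≤ k) (hG : G.MemC k) :
    HasQuotient G (⊤ : SimpleGraph Bool) ∨ HasQuotient G (cycleGraph 5) := by
  have := finite_of_isCritical (by omega) hG.1
  have := nontrivial_of_isCritical hk hG.1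
  obtain ⟨I, _, _, Q, hQ, hGQ⟩ := exists_isPrime_hasQuotient G
  have hfree := isP5CoP5Free_of_isIndContained hGQ.isIndContained hG.2
  by_cases h5 : cycleGraph 5 ⊴ Q
  · exact .inr (hGQ.trans (hQ.hasQuotient_cycleGraph_five hfree h5))
  · obtain rfl := eq_top_of_isCritical_of_hasQuotient (by omega) hG.1 hfree h5 hGQ
    exact .inl (hGQ.trans hasQuotient_top_bool)

end P5CoP5

open P5CoP5 in
theorem mainTheorem1_general {V : Type u} (G : SimpleGraph V) (k : ℕ) (hk : 2 ≤ k) :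
    G.MemC k ↔ (G.IsConstruction1 k ∨ G.IsConstruction2 k) := by
  have hk0 : 0 < k := by omega
  rw [isConstruction1_iff hk0, isConstruction2_iff hk0, ← and_or_left, iff_self_and]
  exact hasQuotient_top_bool_or_cycleGraph_five hk

theorem mainTheorem1 {V : Type u} [Finite V] (G : SimpleGraph V) (k : ℕ) (hk : 2 ≤ k) :
    G.MemC k ↔ (G.IsConstruction1 k ∨ G.IsConstruction2 k) :=
  mainTheorem1_general G k hk
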